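/- **Noise model.** Let $N$ be a ground set with $n$ elements and $f:2^N\to\mathbb R$. A noisy oracle for $f$ with noise distribution $\mathcal D$ is $\widetilde f(T)=\xi_T f(T)$, where the multipliers $\xi_T\sim\mathcal D$, $T\subseteq N$, are independent (one fixed draw per set). The distribution $\mathcal D$ has a *generalized exponential tail* if either (a) for some $x_0>0$ it has on $(x_0,\infty)$ the density $e^{-g(x)}$, with $g(x)=\sum_i a_i x^{\alpha_i}$, real exponents $\alpha_0>\alpha_1\ge\alpha_2\ge\cdots$, $\alpha_0\ge 1$ and $a_0>0$; or (b) its support is bounded above, and it has an atom at its supremum $M$ or, near $M$, a density that is continuous (from the left) and nonzero at $M$. **Algorithm.** All logarithms are to base 2. For a budget $k$ let $\ell=\lceil 25\log n\rceil$ if $k\ge 2400\log n$ and $\ell=\lceil 33\log\log n\rceil$ if $k<2400\log n$. Let $H\subseteq N$ be a set of size $\ell$ (the smoothing set), and for $S\subseteq N$, $a\in N$ let $$\widetilde F(S\cup a)=\frac1{2^{\ell}}\sum_{H'\subseteq H}\widetilde f\bigl(S\cup H'\cup\{a\}\bigr).$$ Smooth-Greedy with budget $k$ and smoothing set $H$ starts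 from $S=\emptyset$ and, while $|S|<k-|H|$, adds to $S$ an element $a\notin S\cup H$ that maximizes $\widetilde F(S\cup a)$; then it returns $S$. Ties are broken arbitrarily. **Statement.** Fix a probability distribution $\mathcal D$ on $\mathbb R$ that has a generalized exponential tail, has positive mean, and satisfies $\mathbb E_{\xi\sim\mathcal D}[e^{-c\xi}]<\infty$ for some $c>0$ (this last condition is automatic if $\xi\ge0$ almost surely). Fix $0<\epsilon<e-1$. Then there is $n_0=n_0(\mathcal D,\epsilon)$ such that for all $n\ge n_0$, every ground set $N$ of size $n$, every monotone submodular $f:2^N\to\mathbb R$ with $f(\emptyset)\ge 0$, every $k\le n$ with $\mathtt{OPT}:=\max_{|T|\le k}f(T)>0$, every $H\subseteq N$ with $|H|=\ell$ and $k>3\ell/\epsilon$, and every noisy oracle for $f$ with noise distribution $\mathcal D$, the following holds with probability at least $1-1/n^3$: Smooth-Greedy with smoothing set $H$ terminates, and every set $S$ that it may return (however ties are broken) satisfies $$f(S\cup H)>\left(\frac{e-1}{2e-1-\epsilon}-2\epsilon\right)\mathtt{OPT}.$$ (As $\epsilon\to0$ the factor tends to $\frac{e-1}{2e-1}\approx0.387$.)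 -/

import Mathlib

open MeasureTheory ProbabilityTheory

/-- Submodularity of a set function on a finite ground set:
`f (S ∪ T) ≤ f S + f T - f (S ∩ T)`. -/
def IsSubmodular {N : Type*} [DecidableEq N] (f : Finset N → ℝ) : Prop :=
  ∀ S T : Finset N, f (S ∪ T) ≤ f S + f T - f (S ∩ T)

/-- The optimum of `f` under the cardinality constraint `k`:
the largest value `f T` over all `T` with at most `k` elements. -/
noncomputable def optValue {N : Type*} [Fintype N] (f : Finset N → ℝ) (k : ℕ) : ℝ :=
  (Finset.univ.filter (fun T : Finset N => T.card ≤ k)).sup' ⟨∅, by simp⟩ f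

/-- The smooth value of `S ∪ {a}` with smoothing set `H` for a set function `g`: the average of
`g (S ∪ (H' ∪ {a}))` over all subsets `H'` of `H`. It is the noisy smooth value when `g` is the
noisy oracle. -/
noncomputable def smoothValue {N : Type*} [DecidableEq N] (g : Finset N → ℝ)
    (H S : Finset N) (a : N) : ℝ :=
  (1 / (2 : ℝ) ^ H.card) * ∑ H' ∈ H.powerset, g (S ∪ (H' ∪ {a}))

/-- `SmoothGreedyReach g k H S`: the variable `S` of Smooth-Greedy, run with value oracle `g`,
budget `k` and smoothing set `H`, can take the value `S` at the head of the while loop. The loop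
starts from `∅`; as long as `|S| < k - |H|`, it adds some maximizer of the smooth value among the
elements that are neither in `H` nor already selected. Ties are broken arbitrarily. -/
inductive SmoothGreedyReach {N : Type*} [DecidableEq N] (g : Finset N → ℝ) (k : ℕ)
    (H : Finset N) : Finset N → Prop
  | init : SmoothGreedyReach g k H ∅
  | step (S : Finset N) (a : N) (hS : SmoothGreedyReach g k H S)
      (hcard : S.card + H.card < k) (ha : a ∉ S ∪ H)
      (hmax : ∀ b, b ∉ S ∪ H → smoothValue g H S b ≤ smoothValue g H S a) :
      SmoothGreedyReach g k H (insert a S)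

/-- `S` is a set that Smooth-Greedy (oracle `g`, budget `k`, smoothing set `H`) may return:
a reachable set at which the loop condition `|S| < k - |H|` fails. -/
def IsSmoothGreedyOutput {N : Type*} [DecidableEq N] (g : Finset N → ℝ) (k : ℕ)
    (H S : Finset N) : Prop :=
  SmoothGreedyReach g k H S ∧ ¬ S.card + H.card < k

/-- The size `ℓ` of the smoothing set: `25 log n` if `k ≥ 2400 log n` and `33 log log n` otherwise,
with logarithms to base two, rounded up to an integer. -/
noncomputable def smoothingSize (n k : ℕ) : ℕ :=
  open Classical in
  if 2400 * Real.logb 2 n ≤ (k : ℝ) then ⌈25 * Real.logb 2 n⌉₊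
  else ⌈33 * Real.logb 2 (Real.logb 2 n)⌉₊

/-- A probability distribution `D` on the line has a generalized exponential tail if either

* beyond some point `x₀` it has the density `exp (-g x)`, where `g x = ∑ i, a i * x ^ α i` with
  exponents `α 0 > α 1 ≥ α 2 ≥ ⋯`, `α 0 ≥ 1`, and positive leading coefficient `a 0` (the sum may
  be infinite; finite sums are those with finitely many nonzero `a i`), or
* its support is bounded above, with supremum `M`, and it has an atom at `M` or, near `M`, a
  density that is continuous and nonzero at `M`. -/
def HasGeneralizedExponentialTail (D : Measure ℝ) : Prop :=
  (∃ (x₀ : ℝ) (a α : ℕ → ℝ) (g : ℝ → ℝ), 0 < x₀ ∧ Antitone α ∧ α 1 < α 0 ∧ 1 ≤ α 0 ∧ 0 < a 0 ∧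
      (∀ x, x₀ < x → HasSum (fun i => a i * x ^ α i) (g x)) ∧
      D.restrict (Set.Ioi x₀) = (volume.restrict (Set.Ioi x₀)).withDensity
        (fun x => ENNReal.ofReal (Real.exp (-g x)))) ∨
  (∃ M : ℝ, D (Set.Ioi M) = 0 ∧
      (0 < D {M} ∨
        ∃ (δ : ℝ) (p : ℝ → ℝ), 0 < δ ∧ Measurable p ∧
          ContinuousWithinAt p (Set.Iic M) M ∧ 0 < p M ∧
          D.restrict (Set.Ioc (M - δ) M) = (volume.restrict (Set.Ioc (M - δ) M)).withDensity
            (fun x => ENNReal.ofReal (p x))))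

/-- `ftilde` is a noisy oracle for `f` with noise distribution `D`: on the probability space
`(Ω, P)`, `ftilde T = ξ T * f T` with multipliers `ξ T ∼ D`, independent over all sets `T`. -/
def IsNoisyOracle {N Ω : Type*} [MeasurableSpace Ω] (D : Measure ℝ) (P : Measure Ω)
    (f : Finset N → ℝ) (ftilde : Finset N → Ω → ℝ) : Prop :=
  ∃ ξ : Finset N → Ω → ℝ, (∀ T, HasLaw (ξ T) D P) ∧ iIndepFun ξ P ∧
    ∀ T ω, ftilde T ω = ξ T ω * f T

open MeasureTheory ProbabilityTheory

/-! Averaging over subsets of `H` makes the noise negligible, after which greedy runs on an almost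
exact surrogate. Write `F` for the smoothing of `f` and `ℓ` for the size of `H`. For `X` disjoint
from `H` the noisy smooth value is a weighted sum of `2 ^ ℓ` independent multipliers. Pairing `H'`
with `H \ H'` shows that the average weight is at least half the largest
(`two_pow_mul_le_sum_powerset`), so no few multipliers dominate. The noise has exponential moments
on both sides, so a Chernoff bound gives relative error of order `ε / k` with failure probability `2
* exp (-c * 2 ^ ℓ / k ^ 2)`. As `2 ^ ℓ` exceeds any fixed multiple of `k ^ 3 * log n`, a union bound
covers all at most `(n + 1) ^ k` sets that greedy could ever query; this removes the dependence of
the run on the noise.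

The rest is deterministic. `F` is monotone and submodular with `f X ≤ F X ≤ f (X ∪ H)`, so the usual
greedy recursion (`SmoothGreedyReach.lower_bound`) gives `f (S ∪ H) ≥ β * f (O' \ H)` for an optimal
`O'`, with `β` close to `1 - 1/e`. Since `f O' ≤ f (O' \ H) + f (S ∪ H)`, the ratio is at least `β /
(1 + β)`, which tends to `(e - 1) / (2e - 1)`. -/

/-! ### Exponential moments of the noise. -/

lemma Real.exp_le_one_add_add_sq_mul_exp_abs (y : ℝ) :
    Real.exp y ≤ 1 + y + y ^ 2 * Real.exp |y| := by
  rcases le_or_gt |y| 1 with h | h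
  · have h1 := (abs_le.1 (Real.abs_exp_sub_one_sub_id_le h)).2
    have h2 : y ^ 2 * 1 ≤ y ^ 2 * Real.exp |y| := by
      gcongr
      exact Real.one_le_exp (abs_nonneg y)
    linarith
  · rcases le_total 0 y with hy | hy
    · rw [abs_of_nonneg hy] at h ⊢
      have : 1 * Real.exp y ≤ y ^ 2 * Real.exp y := by
        gcongr
        nlinarith
      linarith
    · have h2 : y ^ 2 * 1 ≤ y ^ 2 * Real.exp |y| := by
        gcongr
        exact Real.one_le_exp (abs_nonneg y)
      have h3 : Real.exp y ≤ 1 := Real.exp_le_one_iff.2 hy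
      rw [abs_of_nonpos hy] at h
      nlinarith

/-- A generalized polynomial with leading exponent at least `1` and positive leading coefficient
grows at least linearly. -/
lemma eventually_linear_le_of_hasSum_rpow {x₀ : ℝ} {a α : ℕ → ℝ} {g : ℝ → ℝ} (hx₀ : 0 < x₀)
    (hα : Antitone α) (hα' : α 1 < α 0) (h1 : 1 ≤ α 0) (ha : 0 < a 0)
    (hg : ∀ x, x₀ < x → HasSum (fun i => a i * x ^ α i) (g x)) :
    ∀ᶠ x in Filter.atTop, a 0 / 2 * x ≤ g x := by
  set y := x₀ + 1 with hy
  have hy0 : 0 < y := by positivity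
  have hsum : Summable (fun i => |a (i + 1) * y ^ α (i + 1)|) :=
    (summable_nat_add_iff 1).2 (hg y (by simp [hy])).summable.abs
  -- Convergence at the single point `y` controls every larger `x`: each term after the leading one
  -- grows by at most `(x / y) ^ α 1`, so together they are `o(x ^ α 0)`.
  set C := ∑' i, |a (i + 1) * y ^ α (i + 1)| with hC
  have hlim : Filter.Tendsto (fun x : ℝ => C / y ^ α 1 * x ^ (-(α 0 - α 1))) Filter.atTop
      (nhds (C / y ^ α 1 * 0)) :=
    (tendsto_rpow_neg_atTop (sub_pos.2 hα')).const_mul _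
  rw [mul_zero] at hlim
  filter_upwards [Filter.eventually_ge_atTop y, Filter.eventually_ge_atTop 1,
    hlim.eventually (ge_mem_nhds (half_pos ha))] with x hxy hx1 hxl
  have hx0 : 0 < x := by linarith
  have hs := hg x (by linarith)
  have hs' : HasSum (fun i => a (i + 1) * x ^ α (i + 1)) (g x - a 0 * x ^ α 0) := by
    simpa using (hasSum_nat_add_iff' 1).2 hs
  have hterm : ∀ i, -(a (i + 1) * x ^ α (i + 1))
      ≤ |a (i + 1) * y ^ α (i + 1)| * (x / y) ^ α 1 := by
    intro i
    have e1 : x ^ α (i + 1) = y ^ α (i + 1) * (x / y) ^ α (i + 1) := by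
      rw [← Real.mul_rpow hy0.le (by positivity)]
      congr 1
      field_simp
    have e2 : (x / y) ^ α (i + 1) ≤ (x / y) ^ α 1 :=
      Real.rpow_le_rpow_of_exponent_le ((one_le_div hy0).2 hxy) (hα (by omega))
    calc -(a (i + 1) * x ^ α (i + 1)) ≤ |a (i + 1) * x ^ α (i + 1)| := neg_le_abs _
      _ = |a (i + 1) * y ^ α (i + 1)| * (x / y) ^ α (i + 1) := by
        rw [e1, ← mul_assoc, abs_mul, abs_of_nonneg (a := (x / y) ^ _) (by positivity)]
      _ ≤ _ := by gcongr
  have hle := hasSum_le hterm hs'.neg (hsum.hasSum.mul_right _)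
  rw [← hC, Real.div_rpow hx0.le hy0.le] at hle
  have e3 : x ^ α 1 = x ^ α 0 * x ^ (-(α 0 - α 1)) := by
    rw [← Real.rpow_add hx0]
    congr 1
    ring
  have e4 : C * (x ^ α 1 / y ^ α 1) = x ^ α 0 * (C / y ^ α 1 * x ^ (-(α 0 - α 1))) := by
    rw [e3]
    ring
  have e5 : x ^ α 0 * (C / y ^ α 1 * x ^ (-(α 0 - α 1))) ≤ x ^ α 0 * (a 0 / 2) := by
    gcongr
  have e6 : x ≤ x ^ α 0 := by
    simpa using Real.rpow_le_rpow_of_exponent_le hx1 h1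
  have e7 : a 0 / 2 * x ≤ a 0 / 2 * x ^ α 0 := by gcongr
  linarith

/-- An unbounded tail has density at most `exp (-(a 0 / 2) * x)` eventually, so the rate `a 0 / 4`
is integrable; a support bounded above makes the exponential bounded. -/
lemma HasGeneralizedExponentialTail.exists_integrable_exp {D : Measure ℝ} [IsFiniteMeasure D]
    (hD : HasGeneralizedExponentialTail D) :
    ∃ c : ℝ, 0 < c ∧ Integrable (fun x => Real.exp (c * x)) D := by
  rcases hD with ⟨x₀, a, α, g, hx₀, hα, hα', h1, ha, hg, hden⟩ | ⟨M, hM, -⟩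
  · obtain ⟨x₁, hx₁⟩ := Filter.eventually_atTop.1
      (eventually_linear_le_of_hasSum_rpow hx₀ hα hα' h1 ha hg)
    set x₂ := max x₀ x₁
    refine ⟨a 0 / 4, by positivity, ?_⟩
    have hleft : IntegrableOn (fun x => Real.exp (a 0 / 4 * x)) (Set.Iic x₂) D := by
      refine Integrable.mono' (integrable_const (Real.exp (a 0 / 4 * x₂)))
        (by fun_prop) ?_
      filter_upwards [ae_restrict_mem measurableSet_Iic] with x hx
      rw [Real.norm_of_nonneg (Real.exp_pos _).le]
      gcongr
      exact hx
    have hright : IntegrableOn (fun x => Real.exp (a 0 / 4 * x)) (Set.Ioi x₂) D := by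
      have hsub : Set.Ioi x₂ ⊆ Set.Ioi x₀ := Set.Ioi_subset_Ioi (le_max_left _ _)
      have hr : D.restrict (Set.Ioi x₂) = (volume.restrict (Set.Ioi x₂)).withDensity
          (fun x => ENNReal.ofReal (Real.exp (-g x))) := by
        rw [← Measure.restrict_restrict_of_subset hsub, hden,
          restrict_withDensity measurableSet_Ioi, Measure.restrict_restrict_of_subset hsub]
      have hle : D.restrict (Set.Ioi x₂) ≤ (volume.restrict (Set.Ioi x₂)).withDensity
          (fun x => ENNReal.ofReal (Real.exp (-(a 0 / 2 * x)))) := by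
        rw [hr]
        refine withDensity_mono ?_
        filter_upwards [ae_restrict_mem measurableSet_Ioi] with x hx
        gcongr
        exact hx₁ x ((le_max_right _ _).trans (le_of_lt hx))
      refine Integrable.mono_measure ?_ hle
      rw [integrable_withDensity_iff (by fun_prop) (by simp)]
      have := integrableOn_exp_mul_Ioi (a := -(a 0 / 4)) (by linarith) x₂
      refine this.congr (ae_of_all _ fun x => ?_)
      simp only
      rw [ENNReal.toReal_ofReal (Real.exp_pos _).le, ← Real.exp_add]
      congr 1
      ring
    have := hleft.union hright
    rwa [Set.Iic_union_Ioi, integrableOn_univ] at this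
  · refine ⟨1, one_pos, Integrable.mono' (integrable_const (Real.exp M)) (by fun_prop) ?_⟩
    have : ∀ᵐ x ∂D, x ≤ M := by
      rw [ae_iff]
      simpa [Set.Ioi] using hM
    filter_upwards [this] with x hx
    rw [Real.norm_of_nonneg (Real.exp_pos _).le, one_mul]
    gcongr

/-- A distribution with exponential moments on both sides has a centred moment generating function
that is at most quadratic in the exponent near `0`. -/
lemma exists_integral_exp_centred_le {D : Measure ℝ} [IsProbabilityMeasure D]
    {c₁ c₂ : ℝ} (hc₁ : 0 < c₁) (hc₂ : 0 < c₂)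
    (h₁ : Integrable (fun x => Real.exp (c₁ * x)) D)
    (h₂ : Integrable (fun x => Real.exp (-(c₂ * x))) D) :
    ∃ K s₀ : ℝ, 0 < K ∧ 0 < s₀ ∧ ∀ s, |s| ≤ s₀ →
      Integrable (fun x => Real.exp (s * (x - ∫ y, y ∂D))) D ∧
      ∫ x, Real.exp (s * (x - ∫ y, y ∂D)) ∂D ≤ Real.exp (K * s ^ 2) := by
  set c := min c₁ c₂ with hc
  have hc0 : 0 < c := lt_min hc₁ hc₂
  set m := ∫ y, y ∂D with hm
  have hdom : Integrable (fun x => Real.exp (c₁ * x) + Real.exp (-(c₂ * x)) + 1) D :=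
    (h₁.add h₂).add (integrable_const 1)
  have hexp : Integrable (fun x => Real.exp (c * |x|)) D := by
    refine hdom.mono' (by fun_prop) (ae_of_all _ fun x => ?_)
    rw [Real.norm_of_nonneg (Real.exp_pos _).le]
    have p1 := Real.exp_pos (c₁ * x)
    have p2 := Real.exp_pos (-(c₂ * x))
    rcases le_total 0 x with hx | hx
    · have : Real.exp (c * |x|) ≤ Real.exp (c₁ * x) := by
        rw [abs_of_nonneg hx]
        gcongr
        exact min_le_left _ _
      linarith
    · have : Real.exp (c * |x|) ≤ Real.exp (-(c₂ * x)) := by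
        rw [abs_of_nonpos hx]
        have := mul_le_mul_of_nonneg_right (min_le_right c₁ c₂) (neg_nonneg.2 hx)
        gcongr
        linarith
      linarith
  have hexp' : Integrable (fun x => Real.exp (c * |x - m|)) D := by
    refine (hexp.mul_const (Real.exp (c * |m|))).mono' (by fun_prop) (ae_of_all _ fun x => ?_)
    rw [Real.norm_of_nonneg (Real.exp_pos _).le, ← Real.exp_add, ← mul_add]
    gcongr
    exact abs_sub x m
  have hid : Integrable (fun x : ℝ => x) D := by
    refine (hexp.const_mul (1 / c)).mono' (by fun_prop) (ae_of_all _ fun x => ?_)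
    have := Real.add_one_le_exp (c * |x|)
    rw [Real.norm_eq_abs, div_mul_eq_mul_div, le_div_iff₀ hc0]
    linarith
  -- Half of the exponent `c` is spent on absorbing the square, through `z ^ 2 / 2 ≤ exp z` at `z =
  -- c / 2 * |x - m|`.
  have hsq : Integrable (fun x => (x - m) ^ 2 * Real.exp (c / 2 * |x - m|)) D := by
    refine (hexp'.const_mul (8 / c ^ 2)).mono' (by fun_prop) (ae_of_all _ fun x => ?_)
    rw [Real.norm_of_nonneg (by positivity)]
    have h := Real.quadratic_le_exp_of_nonneg (x := c / 2 * |x - m|) (by positivity)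
    have h0 : 0 ≤ c / 2 * |x - m| := by positivity
    have h' : (x - m) ^ 2 ≤ 8 / c ^ 2 * Real.exp (c / 2 * |x - m|) := by
      rw [div_mul_eq_mul_div, le_div_iff₀ (by positivity)]
      have : (c / 2 * |x - m|) ^ 2 = c ^ 2 / 4 * (x - m) ^ 2 := by
        rw [mul_pow, sq_abs]
        ring
      nlinarith
    calc (x - m) ^ 2 * Real.exp (c / 2 * |x - m|)
        ≤ 8 / c ^ 2 * Real.exp (c / 2 * |x - m|) * Real.exp (c / 2 * |x - m|) := by gcongr
      _ = 8 / c ^ 2 * Real.exp (c * |x - m|) := by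
        rw [mul_assoc, ← Real.exp_add]
        congr 2
        ring
  set A := ∫ x, (x - m) ^ 2 * Real.exp (c / 2 * |x - m|) ∂D with hA
  have hA0 : 0 ≤ A := integral_nonneg fun x => by positivity
  refine ⟨A + 1, c / 2, by positivity, by positivity, fun s hs => ?_⟩
  have hint : Integrable (fun x => Real.exp (s * (x - m))) D := by
    refine hexp'.mono' (by fun_prop) (ae_of_all _ fun x => ?_)
    rw [Real.norm_of_nonneg (Real.exp_pos _).le]
    refine Real.exp_le_exp.2 ((le_abs_self _).trans ?_)
    rw [abs_mul]
    gcongr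
    linarith
  refine ⟨hint, ?_⟩
  have hlin : Integrable (fun x => s * (x - m)) D := (hid.sub (integrable_const m)).const_mul s
  -- Centring kills the linear term, which leaves a bound quadratic in `s`.
  have hzero : ∫ x, s * (x - m) ∂D = 0 := by
    rw [integral_const_mul, integral_sub hid (integrable_const m)]
    simp [hm]
  have hmaj : Integrable (fun x => 1 + s * (x - m) +
      s ^ 2 * ((x - m) ^ 2 * Real.exp (c / 2 * |x - m|))) D :=
    ((integrable_const 1).add hlin).add (hsq.const_mul _)
  calc ∫ x, Real.exp (s * (x - m)) ∂D
      ≤ ∫ x, (1 + s * (x - m) + s ^ 2 * ((x - m) ^ 2 * Real.exp (c / 2 * |x - m|))) ∂D := by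
        refine integral_mono hint hmaj fun x => ?_
        refine (Real.exp_le_one_add_add_sq_mul_exp_abs _).trans ?_
        rw [mul_pow, abs_mul, mul_assoc]
        gcongr
    _ = 1 + s ^ 2 * A := by
        have e : ∫ x, (1 + s * (x - m)) ∂D = 1 := by
          rw [integral_add (integrable_const 1) hlin, hzero]
          simp
        have hlin' : Integrable (fun x => 1 + s * (x - m)) D := (integrable_const 1).add hlin
        rw [integral_add hlin' (hsq.const_mul _), e, integral_const_mul]
    _ ≤ 1 + (A + 1) * s ^ 2 := by nlinarith [sq_nonneg s]
    _ ≤ Real.exp ((A + 1) * s ^ 2) := by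
        have := Real.add_one_le_exp ((A + 1) * s ^ 2)
        linarith

/-! ### Chernoff bounds for weighted sums. -/

section Concentration

variable {ι Ω : Type*} [MeasurableSpace Ω] {P : Measure Ω} {D : Measure ℝ} {ξ : ι → Ω → ℝ}
  {m K s₀ : ℝ}

/-- Chernoff bound for a weighted sum of independent variables with a common law whose centred
moment generating function is at most quadratic near `0`. -/
lemma measureReal_weighted_sum_ge_le [IsProbabilityMeasure P]
    (hlaw : ∀ i, HasLaw (ξ i) D P) (hind : iIndepFun ξ P)
    (hmgf : ∀ s, |s| ≤ s₀ → Integrable (fun x => Real.exp (s * (x - m))) D ∧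
      ∫ x, Real.exp (s * (x - m)) ∂D ≤ Real.exp (K * s ^ 2))
    (U : Finset ι) (v : ι → ℝ) {t : ℝ} (ht : 0 ≤ t) (b : ℝ)
    (hv : ∀ i, |t * v i| ≤ s₀) :
    P.real {ω | b ≤ ∑ i ∈ U, v i * (ξ i ω - m)} ≤
      Real.exp (-t * b + K * t ^ 2 * ∑ i ∈ U, v i ^ 2) := by
  set X : ι → Ω → ℝ := fun i ω => v i * (ξ i ω - m) with hX
  have hXm : ∀ i, AEMeasurable (X i) P := fun i =>
    ((hlaw i).aemeasurable.sub_const m).const_mul (v i)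
  have hXind : iIndepFun X P := by
    have : ∀ i, Measurable (fun x : ℝ => v i * (x - m)) := fun i => by fun_prop
    exact hind.comp (fun i x => v i * (x - m)) this
  have hrew : ∀ i, (fun ω => Real.exp (t * X i ω)) =
      (fun x => Real.exp (t * v i * (x - m))) ∘ ξ i := fun i => by
    ext ω
    simp only [X, Function.comp]
    rw [mul_assoc]
  have hXint : ∀ i ∈ U, Integrable (fun ω => Real.exp (t * X i ω)) P := fun i _ => by
    rw [hrew]
    refine Integrable.comp_aemeasurable ?_ (hlaw i).aemeasurable
    rw [(hlaw i).map_eq]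
    exact (hmgf _ (hv i)).1
  have hXmgf : ∀ i, mgf (X i) P t ≤ Real.exp (K * (t * v i) ^ 2) := fun i => by
    have : mgf (X i) P t = ∫ x, Real.exp (t * v i * (x - m)) ∂D := by
      rw [mgf, hrew]
      exact (hlaw i).integral_comp (by fun_prop)
    rw [this]
    exact (hmgf _ (hv i)).2
  have hint : Integrable (fun ω => Real.exp (t * (∑ i ∈ U, X i) ω)) P := by
    -- A non-integrable function has integral `0` by convention, so it suffices that the moment
    -- generating function, a product of positive factors by independence, is nonzero.
    refine not_imp_comm.1 integral_undef (ne_of_gt ?_)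
    change 0 < mgf (∑ i ∈ U, X i) P t
    rw [hXind.mgf_sum₀ hXm]
    exact Finset.prod_pos fun i hi => mgf_pos (hXint i hi)
  have h := measure_ge_le_exp_mul_mgf (X := ∑ i ∈ U, X i) (μ := P) b ht hint
  have hset : {ω | b ≤ ∑ i ∈ U, v i * (ξ i ω - m)} = {ω | b ≤ (∑ i ∈ U, X i) ω} := by
    ext ω
    simp [X]
  rw [hset]
  refine h.trans ?_
  rw [hXind.mgf_sum₀ hXm, Real.exp_add]
  gcongr
  calc ∏ i ∈ U, mgf (X i) P t ≤ ∏ i ∈ U, Real.exp (K * (t * v i) ^ 2) :=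
        Finset.prod_le_prod (fun i _ => mgf_nonneg) fun i _ => hXmgf i
    _ = Real.exp (K * t ^ 2 * ∑ i ∈ U, v i ^ 2) := by
        rw [← Real.exp_sum, Finset.mul_sum]
        congr 1
        exact Finset.sum_congr rfl fun i _ => by ring

/-- Relative concentration of a nonnegatively weighted sum with weights at most `V` and total
weight at least `R * V`. -/
lemma measureReal_weighted_sum_relative_error_le [IsProbabilityMeasure P]
    (hlaw : ∀ i, HasLaw (ξ i) D P) (hind : iIndepFun ξ P) (hm : 0 < m) (hK : 0 < K)
    (hmgf : ∀ s, |s| ≤ s₀ → Integrable (fun x => Real.exp (s * (x - m))) D ∧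
      ∫ x, Real.exp (s * (x - m)) ∂D ≤ Real.exp (K * s ^ 2))
    (U : Finset ι) (v : ι → ℝ) {V R δ : ℝ} (hδ : 0 < δ) (hδK : δ * m ≤ 2 * K * s₀)
    (hv0 : ∀ i ∈ U, 0 ≤ v i) (hvV : ∀ i ∈ U, v i ≤ V) (hV : 0 < V)
    (hR : R * V ≤ ∑ i ∈ U, v i) :
    P.real {ω | δ * (m * ∑ i ∈ U, v i) < |∑ i ∈ U, v i * ξ i ω - m * ∑ i ∈ U, v i|} ≤
      2 * Real.exp (-((δ * m) ^ 2 / (4 * K) * R)) := by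
  classical
  set W := ∑ i ∈ U, v i with hW
  -- The minimizer of `-t * δ * m * W + K * t ^ 2 * V * W`, where `V * W` bounds the sum of the
  -- squared weights.
  set t := δ * m / (2 * K * V) with htdef
  have ht : 0 < t := by positivity
  have hs₀ : 0 ≤ s₀ := by
    by_contra h
    push Not at h
    nlinarith [mul_pos hδ hm]
  have hsq : ∑ i ∈ U, v i ^ 2 ≤ V * W := by
    rw [hW, Finset.mul_sum]
    refine Finset.sum_le_sum fun i hi => ?_
    rw [sq]
    exact mul_le_mul_of_nonneg_right (hvV i hi) (hv0 i hi)
  have htV : t * V ≤ s₀ := by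
    have : t * V = δ * m / (2 * K) := by
      rw [htdef]
      field_simp
    rw [this, div_le_iff₀ (by positivity)]
    linarith
  have hexp : -t * (δ * (m * W)) + K * t ^ 2 * ∑ i ∈ U, v i ^ 2
      ≤ -((δ * m) ^ 2 / (4 * K) * R) := by
    have h1 : K * t ^ 2 * ∑ i ∈ U, v i ^ 2 ≤ K * t ^ 2 * (V * W) := by gcongr
    have h2 : -t * (δ * (m * W)) + K * t ^ 2 * (V * W) = -((δ * m) ^ 2 / (4 * K) * (W / V)) := by
      rw [htdef]
      field_simp
      ring
    have h3 : (δ * m) ^ 2 / (4 * K) * R ≤ (δ * m) ^ 2 / (4 * K) * (W / V) := by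
      gcongr
      rwa [le_div_iff₀ hV]
    linarith
  have side : ∀ σ : ℝ, |σ| = 1 →
      P.real {ω | δ * (m * W) ≤ σ * (∑ i ∈ U, v i * ξ i ω - m * W)} ≤
        Real.exp (-((δ * m) ^ 2 / (4 * K) * R)) := by
    intro σ hσ
    have hσ2 : σ ^ 2 = 1 := by rw [← sq_abs, hσ, one_pow]
    -- The weights vanish off `U` because the Chernoff bound constrains `t * v i` for every index;
    -- the sign `σ` selects the upper or the lower tail.
    set w : ι → ℝ := fun i => if i ∈ U then σ * v i else 0 with hw
    have h := measureReal_weighted_sum_ge_le hlaw hind hmgf U w ht.le (δ * (m * W)) (by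
      intro i
      by_cases hi : i ∈ U
      · simp only [hw, hi, if_true]
        rw [abs_mul, abs_mul, hσ, one_mul, abs_of_pos ht, abs_of_nonneg (hv0 i hi)]
        exact (mul_le_mul_of_nonneg_left (hvV i hi) ht.le).trans htV
      · simpa [hw, hi] using hs₀)
    have e1 : ∑ i ∈ U, w i ^ 2 = ∑ i ∈ U, v i ^ 2 :=
      Finset.sum_congr rfl fun i hi => by simp [hw, hi, mul_pow, hσ2]
    have e2 : ∀ ω, ∑ i ∈ U, w i * (ξ i ω - m) = σ * (∑ i ∈ U, v i * ξ i ω - m * W) := by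
      intro ω
      rw [hW, Finset.mul_sum, ← Finset.sum_sub_distrib, Finset.mul_sum]
      refine Finset.sum_congr rfl fun i hi => ?_
      simp only [hw, hi, if_true]
      ring
    simp only [e1, e2] at h
    exact h.trans (Real.exp_le_exp.2 hexp)
  have hsub : {ω | δ * (m * W) < |∑ i ∈ U, v i * ξ i ω - m * W|} ⊆
      {ω | δ * (m * W) ≤ 1 * (∑ i ∈ U, v i * ξ i ω - m * W)} ∪
      {ω | δ * (m * W) ≤ (-1) * (∑ i ∈ U, v i * ξ i ω - m * W)} := by
    intro ω hω
    rw [Set.mem_ofPred_eq, lt_abs] at hω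
    rcases hω with h | h
    · left
      simpa using h.le
    · right
      simp only [Set.mem_ofPred_eq]
      linarith
  refine (measureReal_mono hsub).trans ((measureReal_union_le _ _).trans ?_)
  have := side 1 (by simp)
  have := side (-1) (by simp)
  linarith

end Concentration

/-! ### Smoothing and greedy with approximate maximizers. -/

section Deterministic

variable {N : Type*} [DecidableEq N]

/-- The average of `g (X ∪ H')` over all subsets `H'` of `H`. -/
noncomputable def smoothing (g : Finset N → ℝ) (H X : Finset N) : ℝ :=
  (1 / (2 : ℝ) ^ H.card) * ∑ H' ∈ H.powerset, g (X ∪ H')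

lemma smoothValue_eq_smoothing (g : Finset N → ℝ) (H S : Finset N) (a : N) :
    smoothValue g H S a = smoothing g H (insert a S) := by
  unfold smoothValue smoothing
  congr 1
  refine Finset.sum_congr rfl fun H' _ => ?_
  congr 1
  ext x
  simp only [Finset.mem_union, Finset.mem_singleton, Finset.mem_insert]
  tauto

lemma smoothing_mono_fun {g g' : Finset N → ℝ} {H X Y : Finset N}
    (h : ∀ H' ⊆ H, g (X ∪ H') ≤ g' (Y ∪ H')) : smoothing g H X ≤ smoothing g' H Y := by
  unfold smoothing
  gcongr with H' hH'
  exact h H' (Finset.mem_powerset.1 hH')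

lemma smoothing_eq_of_const {g : Finset N → ℝ} {H X : Finset N} {c : ℝ}
    (h : ∀ H' ⊆ H, g (X ∪ H') = c) : smoothing g H X = c := by
  unfold smoothing
  rw [Finset.sum_congr rfl fun H' hH' => h H' (Finset.mem_powerset.1 hH')]
  simp

lemma monotone_smoothing {f : Finset N → ℝ} (hf : Monotone f) (H : Finset N) :
    Monotone (smoothing f H) := fun _ _ h =>
  smoothing_mono_fun fun _ _ => hf (Finset.union_subset_union_left h)

lemma IsSubmodular.smoothing {f : Finset N → ℝ} (hf : IsSubmodular f) (H : Finset N) :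
    IsSubmodular (smoothing f H) := by
  intro S T
  unfold _root_.smoothing
  rw [← mul_add, ← mul_sub, ← Finset.sum_add_distrib, ← Finset.sum_sub_distrib]
  gcongr with H' hH'
  have := hf (S ∪ H') (T ∪ H')
  rwa [← Finset.union_union_distrib_right, ← Finset.inter_union_distrib_right] at this

lemma smoothing_le {f : Finset N → ℝ} (hf : Monotone f) (H X : Finset N) :
    smoothing f H X ≤ f (X ∪ H) :=
  (smoothing_mono_fun (g' := fun _ => f (X ∪ H)) (Y := X) fun _ h =>
    hf (Finset.union_subset_union_right h)).trans_eq (smoothing_eq_of_const fun _ _ => rfl)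

lemma le_smoothing {f : Finset N → ℝ} (hf : Monotone f) (H X : Finset N) :
    f X ≤ smoothing f H X :=
  (smoothing_eq_of_const (g := fun _ => f X) (H := H) (X := X) fun _ _ => rfl).symm.le.trans
    (smoothing_mono_fun fun _ _ => hf Finset.subset_union_left)

/-- Pair `H'` with its complement in `H`: by submodularity and nonnegativity the two values add up
to at least `f (X ∪ H)`. This is the balance of weights that concentration needs. -/
lemma two_pow_mul_le_sum_powerset {f : Finset N → ℝ} (hf : Monotone f) (hs : IsSubmodular f)
    (h0 : 0 ≤ f ∅) (H X : Finset N) :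
    (2 : ℝ) ^ H.card * f (X ∪ H) ≤ 2 * ∑ H' ∈ H.powerset, f (X ∪ H') := by
  have hcompl : ∑ H' ∈ H.powerset, f (X ∪ (H \ H')) = ∑ H' ∈ H.powerset, f (X ∪ H') := by
    refine Finset.sum_bij' (fun H' _ => H \ H') (fun H' _ => H \ H') ?_ ?_ ?_ ?_ ?_
    · intro H' _
      simp
    · intro H' _
      simp
    · intro H' h
      simpa using Finset.mem_powerset.1 h
    · intro H' h
      simpa using Finset.mem_powerset.1 h
    · intro H' _
      rfl
  calc (2 : ℝ) ^ H.card * f (X ∪ H) = ∑ H' ∈ H.powerset, f (X ∪ H) := by simp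
    _ ≤ ∑ H' ∈ H.powerset, (f (X ∪ H') + f (X ∪ (H \ H'))) := by
      refine Finset.sum_le_sum fun H' h => ?_
      have h1 := hs (X ∪ H') (X ∪ (H \ H'))
      have h2 : (X ∪ H') ∪ (X ∪ (H \ H')) = X ∪ H := by
        rw [← Finset.union_union_distrib_left,
          Finset.union_sdiff_of_subset (Finset.mem_powerset.1 h)]
      have h3 := hf (Finset.empty_subset ((X ∪ H') ∩ (X ∪ (H \ H'))))
      rw [h2] at h1
      linarith
    _ = _ := by
      rw [Finset.sum_add_distrib, hcompl]
      ring

/-- Diminishing returns: an element `b` outside `S`, added after part of `O`, gains no more than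
when added to `S` directly. -/
lemma IsSubmodular.union_le_add_sum {F : Finset N → ℝ} (hs : IsSubmodular F)
    (S O : Finset N) : F (S ∪ O) ≤ F S + ∑ b ∈ O, (F (insert b S) - F S) := by
  induction O using Finset.induction_on with
  | empty => simp
  | insert b O hb ih =>
    rw [Finset.sum_insert hb]
    by_cases hbS : b ∈ S
    · have e : S ∪ insert b O = S ∪ O := by
        rw [Finset.union_insert, Finset.insert_eq_self]
        exact Finset.mem_union_left _ hbS
      rw [e, Finset.insert_eq_self.2 hbS]
      linarith
    · have h := hs (S ∪ O) (insert b S)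
      have e1 : (S ∪ O) ∪ insert b S = S ∪ insert b O := by
        ext x
        simp only [Finset.mem_union, Finset.mem_insert]
        tauto
      have e2 : (S ∪ O) ∩ insert b S = S := by
        ext x
        simp only [Finset.mem_union, Finset.mem_insert, Finset.mem_inter]
        constructor
        · rintro ⟨h1 | h1, h2 | h2⟩
          · exact h1
          · exact h1
          · exact absurd (h2 ▸ h1) hb
          · exact h2
        · exact fun h => ⟨Or.inl h, Or.inr h⟩
      rw [e1, e2] at h
      linarith

/-- One greedy step with multiplicative error `η`. -/
lemma greedy_step {F : Finset N → ℝ} (hF : Monotone F) (hs : IsSubmodular F)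
    (h0 : 0 ≤ F ∅) {η : ℝ} (hη : 0 ≤ η) {H S O : Finset N} {a : N} {k : ℕ} (hk : 0 < k)
    (hO : O.card ≤ k) (hOH : Disjoint O H)
    (hmax : ∀ b, b ∉ S ∪ H → F (insert b S) ≤ (1 + η) * F (insert a S)) :
    (1 - 1 / (k : ℝ)) * F S + F O / k ≤ (1 + η) * F (insert a S) := by
  have hnn : ∀ X, 0 ≤ F X := fun X => h0.trans (hF (Finset.empty_subset X))
  -- Nonnegativity of the gain covers the elements of `O` already in `S` and later allows `O.card`
  -- to be replaced by `k`.
  have hgain : F S ≤ (1 + η) * F (insert a S) := by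
    have h1 : F S ≤ F (insert a S) := hF (Finset.subset_insert a S)
    nlinarith [mul_nonneg hη (hnn (insert a S))]
  have h1 : F O ≤ F S + ∑ b ∈ O, (F (insert b S) - F S) :=
    (hF Finset.subset_union_right).trans (hs.union_le_add_sum S O)
  have h2 : ∑ b ∈ O, (F (insert b S) - F S) ≤ ∑ b ∈ O, ((1 + η) * F (insert a S) - F S) := by
    refine Finset.sum_le_sum fun b hb => ?_
    by_cases hbS : b ∈ S
    · rw [Finset.insert_eq_self.2 hbS]
      linarith
    · have := hmax b (by
        rw [Finset.mem_union, not_or]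
        exact ⟨hbS, Finset.disjoint_left.1 hOH hb⟩)
      linarith
  rw [Finset.sum_const, nsmul_eq_mul] at h2
  have h3 : (O.card : ℝ) * ((1 + η) * F (insert a S) - F S)
      ≤ k * ((1 + η) * F (insert a S) - F S) := by
    gcongr
  have hk' : (0 : ℝ) < k := by exact_mod_cast hk
  have h4 : F O ≤ F S + k * ((1 + η) * F (insert a S) - F S) := by linarith
  have h5 : F O / k ≤ F S / k + ((1 + η) * F (insert a S) - F S) := by
    rw [div_le_iff₀ hk', add_mul, div_mul_cancel₀ _ hk'.ne']
    linarith
  have h6 : (1 - 1 / (k : ℝ)) * F S = F S - F S / k := by ring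
  linarith

lemma SmoothGreedyReach.disjoint {g : Finset N → ℝ} {k : ℕ} {H S : Finset N}
    (h : SmoothGreedyReach g k H S) : Disjoint S H := by
  induction h with
  | init => simp
  | step S a _ _ ha _ ih =>
    rw [Finset.disjoint_insert_left]
    exact ⟨fun h => ha (Finset.mem_union_right _ h), ih⟩

lemma SmoothGreedyReach.card_le {g : Finset N → ℝ} {k : ℕ} {H S : Finset N}
    (h : SmoothGreedyReach g k H S) (hk : H.card ≤ k) : S.card + H.card ≤ k := by
  induction h with
  | init => simpa
  | step S a _ hc _ _ _ =>
    have := Finset.card_insert_le a S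
    omega

/-- Lower bound for the smooth value along every run of Smooth-Greedy with an oracle whose smooth
values are accurate up to a multiplicative error. -/
lemma SmoothGreedyReach.lower_bound {f g : Finset N → ℝ} (hf : Monotone f) (hs : IsSubmodular f)
    (h0 : 0 ≤ f ∅) {η : ℝ} (hη : 0 ≤ η) {H S O : Finset N} {k : ℕ} (hk : 0 < k)
    (hO : O.card ≤ k) (hOH : Disjoint O H)
    (hacc : ∀ S a b, Disjoint (insert a S) H → Disjoint (insert b S) H → S.card + H.card < k →
      smoothing g H (insert b S) ≤ smoothing g H (insert a S) →
      smoothing f H (insert b S) ≤ (1 + η) * smoothing f H (insert a S))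
    (h : SmoothGreedyReach g k H S) :
    (1 - (1 - 1 / (k : ℝ)) ^ S.card) * f O ≤ (1 + η) ^ S.card * smoothing f H S := by
  have hF := monotone_smoothing hf H
  have hFs := hs.smoothing H
  have hF0 : 0 ≤ smoothing f H ∅ := h0.trans (le_smoothing hf H ∅)
  have hk1 : (0 : ℝ) ≤ 1 - 1 / (k : ℝ) := by
    rw [sub_nonneg, div_le_one (by exact_mod_cast hk)]
    exact_mod_cast hk
  have hfO : 0 ≤ f O := h0.trans (hf (Finset.empty_subset O))
  induction h with
  | init => simpa using hF0
  | step S a hS hc ha hmax ih =>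
    have haS : a ∉ S := fun h => ha (Finset.mem_union_left _ h)
    have hdis : ∀ b, b ∉ S ∪ H → Disjoint (insert b S) H := fun b hb =>
      Finset.disjoint_insert_left.2 ⟨fun h => hb (Finset.mem_union_right _ h), hS.disjoint⟩
    have hst := greedy_step (F := smoothing f H) (a := a) (S := S) hF hFs hF0 hη hk hO hOH
      (fun b hb => hacc S a b (hdis a ha) (hdis b hb) hc (by
        simpa only [smoothValue_eq_smoothing] using hmax b hb))
    rw [Finset.card_insert_of_notMem haS]
    set t := S.card
    set q := 1 - 1 / (k : ℝ)
    have hp : (1 : ℝ) ≤ (1 + η) ^ t := one_le_pow₀ (by linarith)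
    have hOk : f O / k = (1 - q) * f O := by
      simp only [q]
      ring
    have hle : f O / k ≤ smoothing f H O / k := by
      gcongr
      exact le_smoothing hf H O
    have hq1 : 0 ≤ (1 - q) * f O := by
      rw [← hOk]
      positivity
    -- The factor `1` is raised to `(1 + η) ^ t`, so that both summands carry the accumulated error
    -- of the earlier steps.
    calc (1 - q ^ (t + 1)) * f O = q * ((1 - q ^ t) * f O) + 1 * ((1 - q) * f O) := by ring
      _ ≤ q * ((1 + η) ^ t * smoothing f H S) + (1 + η) ^ t * ((1 - q) * f O) := by gcongr
      _ = (1 + η) ^ t * (q * smoothing f H S + f O / k) := by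
        rw [hOk]
        ring
      _ ≤ (1 + η) ^ t * ((1 + η) * smoothing f H (insert a S)) := by
        gcongr
        linarith
      _ = _ := by ring

lemma exists_isSmoothGreedyOutput [Fintype N] (g : Finset N → ℝ) {k : ℕ}
    (hk : k ≤ Fintype.card N) (H : Finset N) :
    ∃ S, IsSmoothGreedyOutput g k H S := by
  by_contra! hcon
  have key : ∀ t : ℕ, ∃ S, SmoothGreedyReach g k H S ∧ t ≤ S.card := by
    intro t
    induction t with
    | zero => exact ⟨∅, .init, by simp⟩
    | succ t ih =>
      obtain ⟨S, hS, ht⟩ := ih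
      have hc : S.card + H.card < k := by
        by_contra hc
        exact hcon S ⟨hS, hc⟩
      have hne : (S ∪ H)ᶜ.Nonempty := by
        rw [← Finset.card_pos, Finset.card_compl]
        have := Finset.card_union_le S H
        omega
      obtain ⟨a, ha, hmax⟩ := Finset.exists_max_image _ (smoothValue g H S) hne
      rw [Finset.mem_compl] at ha
      refine ⟨insert a S, .step S a hS hc ha fun b hb => hmax b (Finset.mem_compl.2 hb), ?_⟩
      rw [Finset.card_insert_of_notMem fun h => ha (Finset.mem_union_left _ h)]
      omega
  obtain ⟨S, -, hS⟩ := key (Fintype.card N + 1)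
  have := Finset.card_le_univ S
  omega

end Deterministic

/-! ### Accuracy at one set, and counting for the union bound. -/

/-- A set of at most `k` elements is listed by a `k`-tuple in `Option N`, padded with `none`. -/
lemma card_filter_card_le_le_pow {N : Type*} [Fintype N] [DecidableEq N] (k : ℕ) :
    (Finset.univ.filter (fun T : Finset N => T.card ≤ k)).card ≤ (Fintype.card N + 1) ^ k := by
  have hsurj : Set.SurjOn
      (fun φ : Fin k → Option N => Finset.univ.biUnion fun i => (φ i).toFinset)
      (Finset.univ : Finset (Fin k → Option N))
      (Finset.univ.filter (fun T : Finset N => T.card ≤ k) : Finset (Finset N)) := by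
    intro T hT
    have hT : T.card ≤ k := by simpa using hT
    refine ⟨fun i => T.toList[(i : ℕ)]?, by simp, ?_⟩
    ext x
    simp only [Finset.mem_biUnion, Finset.mem_univ, true_and, Option.mem_toFinset, Option.mem_def]
    rw [← Finset.mem_toList, List.mem_iff_getElem?]
    constructor
    · rintro ⟨i, hi⟩
      exact ⟨i, hi⟩
    · rintro ⟨i, hi⟩
      have hlt : i < T.toList.length := by
        by_contra h
        rw [List.getElem?_eq_none (by omega)] at hi
        simp at hi
      rw [Finset.length_toList] at hlt
      exact ⟨⟨i, by omega⟩, hi⟩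
  have h := Finset.card_le_card_of_surjOn _ hsurj
  simpa using h

/-- Subadditivity for a finite union. -/
lemma one_sub_card_mul_le_measureReal {ι Ω : Type*} [MeasurableSpace Ω] {P : Measure Ω}
    [IsProbabilityMeasure P] (s : Finset ι) (B : ι → Set Ω) (G : Set Ω) {p : ℝ}
    (hB : ∀ i ∈ s, P.real (B i) ≤ p) (hG : ∀ ω, (∀ i ∈ s, ω ∉ B i) → ω ∈ G) :
    1 - s.card * p ≤ P.real G := by
  have hcov : (Set.univ : Set Ω) ⊆ G ∪ ⋃ i ∈ s, B i := by
    intro ω _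
    by_cases h : ∀ i ∈ s, ω ∉ B i
    · exact Or.inl (hG ω h)
    · push Not at h
      obtain ⟨i, hi, hω⟩ := h
      exact Or.inr (Set.mem_biUnion hi hω)
  have h1 : (1 : ℝ) ≤ P.real G + P.real (⋃ i ∈ s, B i) := by
    have := (measureReal_mono (μ := P) hcov).trans (measureReal_union_le _ _)
    simpa using this
  have h2 : P.real (⋃ i ∈ s, B i) ≤ s.card * p := by
    refine (measureReal_biUnion_finset_le s B).trans ?_
    rw [← nsmul_eq_mul]
    exact Finset.sum_le_card_nsmul _ _ _ hB
  linarith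

/-- Relative accuracy of the noisy smooth value at a single set. -/
lemma IsNoisyOracle.measureReal_smoothing_error_le {N Ω : Type*} [DecidableEq N]
    [MeasurableSpace Ω] {D : Measure ℝ} {P : Measure Ω} [IsProbabilityMeasure P]
    {f : Finset N → ℝ} {ftilde : Finset N → Ω → ℝ} (hf : Monotone f) (hs : IsSubmodular f)
    (h0 : 0 ≤ f ∅) (hor : IsNoisyOracle D P f ftilde) {m K s₀ δ : ℝ} (hm : 0 < m) (hK : 0 < K)
    (hmgf : ∀ s, |s| ≤ s₀ → Integrable (fun x => Real.exp (s * (x - m))) D ∧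
      ∫ x, Real.exp (s * (x - m)) ∂D ≤ Real.exp (K * s ^ 2))
    (hδ : 0 < δ) (hδK : δ * m ≤ 2 * K * s₀) {H X : Finset N} (hX : Disjoint X H) :
    P.real {ω | δ * (m * smoothing f H X) <
        |smoothing (fun T => ftilde T ω) H X - m * smoothing f H X|} ≤
      2 * Real.exp (-((δ * m) ^ 2 / (4 * K) * (2 ^ H.card / 2))) := by
  obtain ⟨ξ, hlaw, hind, hft⟩ := hor
  have hnn : ∀ T, 0 ≤ f T := fun T => h0.trans (hf (Finset.empty_subset T))
  rcases (hnn (X ∪ H)).eq_or_lt with hz | hpos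
  -- If `f (X ∪ H) = 0`, all weights vanish and multiplicative noise has no effect.
  · have hz' : ∀ H' ⊆ H, f (X ∪ H') = 0 := fun H' h =>
      le_antisymm (hz ▸ hf (Finset.union_subset_union_right h)) (hnn _)
    have e1 : smoothing f H X = 0 := smoothing_eq_of_const hz'
    have e2 : ∀ ω, smoothing (fun T => ftilde T ω) H X = 0 := fun ω =>
      smoothing_eq_of_const fun H' h => by rw [hft, hz' H' h, mul_zero]
    simp only [e1, e2]
    simp
    positivity
  -- Disjointness of `X` and `H` makes the sets `X ∪ H'` distinct, so that their multipliers are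
  -- independent.
  · have hinj : Set.InjOn (fun H' => X ∪ H') (H.powerset : Set (Finset N)) := by
      intro A hA B hB hAB
      have hA' := Finset.mem_powerset.1 hA
      have hB' := Finset.mem_powerset.1 hB
      have hd : ∀ C ⊆ H, (X ∪ C) \ X = C := fun C hC => by
        rw [Finset.union_sdiff_left, Finset.sdiff_eq_self_iff_disjoint]
        exact (hX.mono_right hC).symm
      simp only at hAB
      rw [← hd A hA', ← hd B hB', hAB]
    set U := H.powerset.image (fun H' => X ∪ H') with hU
    have hsum : ∀ g : Finset N → ℝ, ∑ T ∈ U, g T = ∑ H' ∈ H.powerset, g (X ∪ H') := fun g =>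
      Finset.sum_image hinj
    have hsm : ∀ g : Finset N → ℝ, smoothing g H X = (1 / (2 : ℝ) ^ H.card) * ∑ T ∈ U, g T :=
      fun g => by rw [hsum, smoothing]
    have h := measureReal_weighted_sum_relative_error_le hlaw hind hm hK hmgf U f
      (V := f (X ∪ H)) (R := 2 ^ H.card / 2) hδ hδK (fun i _ => hnn i) (by
        intro T hT
        obtain ⟨H', h', rfl⟩ := Finset.mem_image.1 hT
        exact hf (Finset.union_subset_union_right (Finset.mem_powerset.1 h'))) hpos (by
        rw [hsum]
        have := two_pow_mul_le_sum_powerset hf hs h0 H X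
        linarith)
    refine (measureReal_mono ?_).trans h
    intro ω hω
    simp only [Set.mem_ofPred_eq, hsm, hft] at hω ⊢
    have hp : (0 : ℝ) < 1 / 2 ^ H.card := by positivity
    have e3 : ∑ T ∈ U, ξ T ω * f T = ∑ T ∈ U, f T * ξ T ω :=
      Finset.sum_congr rfl fun _ _ => mul_comm _ _
    rw [e3, mul_left_comm m, ← mul_sub, abs_mul, abs_of_pos hp, mul_left_comm δ] at hω
    exact lt_of_mul_lt_mul_left hω hp.le

/-- The size of the smoothing set is large enough for a union bound over all sets of size at most
the budget. -/
lemma exists_le_two_pow_smoothingSize (C : ℝ) :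
    ∃ n₀ : ℕ, 2 ≤ n₀ ∧ ∀ n : ℕ, n₀ ≤ n → ∀ k : ℕ, k ≤ n →
      C * k ^ 3 * Real.logb 2 n ≤ 2 ^ smoothingSize n k := by
  have hlim : Filter.Tendsto (fun n : ℕ => Real.logb 2 (n : ℝ)) Filter.atTop Filter.atTop :=
    (Real.tendsto_logb_atTop (by norm_num)).comp tendsto_natCast_atTop_atTop
  set C' := max C 1 with hC'
  have hC1 : 1 ≤ C' := le_max_right _ _
  -- For a large budget, `n ≥ C'` suffices, since `k ≤ n` and `L ≤ n`; for a small one, `k < 2400 *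
  -- L`, and `L` must absorb `C' * 2400 ^ 3`.
  obtain ⟨n₁, hn₁⟩ := Filter.eventually_atTop.1
    ((hlim.eventually_ge_atTop (C' * 2400 ^ 3)).and
      (tendsto_natCast_atTop_atTop.eventually_ge_atTop C'))
  refine ⟨max n₁ 2, le_max_right _ _, fun n hn k hk => ?_⟩
  obtain ⟨hL, hnC⟩ := hn₁ n ((le_max_left _ _).trans hn)
  have hn2 : 2 ≤ n := (le_max_right _ _).trans hn
  have hnpos : (0 : ℝ) < n := by positivity
  set L := Real.logb 2 (n : ℝ) with hLdef
  have hL1 : 1 ≤ L := by nlinarith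
  have hLn : L ≤ n := by
    rw [hLdef, Real.logb_le_iff_le_rpow (by norm_num) hnpos, Real.rpow_natCast]
    exact_mod_cast Nat.lt_two_pow_self.le
  have hceil : ∀ x y : ℝ, 0 < y → ∀ j : ℕ, x = j * Real.logb 2 y →
      y ^ j ≤ (2 : ℝ) ^ ⌈x⌉₊ := by
    intro x y hy j hx
    have h : (2 : ℝ) ^ x ≤ 2 ^ ((⌈x⌉₊ : ℕ) : ℝ) :=
      Real.rpow_le_rpow_of_exponent_le (by norm_num) (Nat.le_ceil x)
    rw [Real.rpow_natCast] at h
    refine le_trans (le_of_eq ?_) h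
    rw [hx, mul_comm, Real.rpow_mul (by norm_num), Real.rpow_logb (by norm_num) (by norm_num) hy,
      Real.rpow_natCast]
  have hC : C * k ^ 3 * L ≤ C' * k ^ 3 * L := by
    gcongr
    exact le_max_left _ _
  refine hC.trans ?_
  unfold smoothingSize
  split_ifs with h
  · refine le_trans ?_ (hceil _ n hnpos 25 (by norm_num))
    have hn1 : (1 : ℝ) ≤ n := by exact_mod_cast (by omega : 1 ≤ n)
    calc C' * k ^ 3 * L ≤ n * n ^ 3 * n := by gcongr
      _ = (n : ℝ) ^ 5 := by ring
      _ ≤ (n : ℝ) ^ 25 := pow_le_pow_right₀ hn1 (by norm_num)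
  · refine le_trans ?_ (hceil _ L (by linarith) 33 (by rw [hLdef]; norm_num))
    push Not at h
    calc C' * k ^ 3 * L ≤ C' * (2400 * L) ^ 3 * L := by gcongr
      _ = C' * 2400 ^ 3 * L ^ 4 := by ring
      _ ≤ L * L ^ 4 := by gcongr
      _ = L ^ 5 := by ring
      _ ≤ L ^ 33 := pow_le_pow_right₀ hL1 (by norm_num)

/-! ### The approximation factor of an accurate run. -/

/-- The hypothesis on `x` rearranges to `x ≥ β / (1 + β) * y`. Each of the two errors in `β` costs
at most `ε / 3` from `1 - 1/e`, and the term `-2 * ε` outweighs all losses. -/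
lemma approximation_factor_bound {ε : ℝ} (hε : 0 < ε) (hε' : ε < Real.exp 1 - 1) {β x y : ℝ}
    (hβ : (1 - min (ε / 3) (1 / 2)) * (1 - Real.exp (-1 + ε / 3)) ≤ β) (hy : 0 < y)
    (hx : β * (y - x) ≤ x) :
    ((Real.exp 1 - 1) / (2 * Real.exp 1 - 1 - ε) - 2 * ε) * y < x := by
  set e := Real.exp 1 with he
  have he2 : 2.7 < e := by
    have := Real.exp_one_gt_d9
    linarith
  have he3 : e < 2.8 := by
    have := Real.exp_one_lt_d9
    linarith
  set u := Real.exp (ε / 3) with hu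
  have hu1 : 1 + ε / 3 ≤ u := by
    have := Real.add_one_le_exp (ε / 3)
    linarith
  have hue : u ≤ e := Real.exp_le_exp.2 (by linarith)
  have hu2 : u - 1 ≤ ε / 3 * u := by
    have h := Real.add_one_le_exp (-(ε / 3))
    have h' : u * Real.exp (-(ε / 3)) = 1 := by
      rw [hu, ← Real.exp_add]
      simp
    nlinarith
  have hexp : Real.exp (-1 + ε / 3) = u / e := by
    rw [Real.exp_add, Real.exp_neg, ← he, ← hu]
    field_simp
  have hlt : Real.exp (-1 + ε / 3) < 1 := by
    rw [Real.exp_lt_one_iff]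
    linarith
  rw [hexp] at hβ hlt
  set μ := min (ε / 3) (1 / 2)
  have hμ1 : μ ≤ ε / 3 := min_le_left _ _
  have hμ2 : μ ≤ 1 / 2 := min_le_right _ _
  have hμ0 : 0 < μ := lt_min (by linarith) (by norm_num)
  have hβ0 : 0 < β := lt_of_lt_of_le (mul_pos (by linarith) (by linarith)) hβ
  have hβ1 : 1 - 1 / e - 2 * ε / 3 ≤ β := by
    have h1 : u / e ≤ 1 / e + ε / 3 := by
      have h2 : u / e - 1 / e ≤ ε / 3 := by
        rw [← sub_div, div_le_iff₀ (by linarith)]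
        nlinarith
      linarith
    have : 0 ≤ u / e := by positivity
    nlinarith
  set q := (e - 1) / (2 * e - 1 - ε) - 2 * ε with hq
  have hxpos : β * y ≤ (1 + β) * x := by linarith
  have hqβ : q * (1 + β) < β := by
    have hden : 0 < 2 * e - 1 - ε := by linarith
    -- The difference of the fractions is `(e - 1) * ε / ((2 * e - 1) * (2 * e - 1 - ε))`, and `ε <
    -- e - 1` makes the denominator at least `4.4 * e`.
    have hq1 : (e - 1) / (2 * e - 1 - ε) ≤ (e - 1) / (2 * e - 1) + ε / 4 := by
      rw [div_add' _ _ _ (by linarith), div_le_div_iff₀ hden (by linarith)]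
      have h1 : 4.4 * e ≤ (2 * e - 1) * (2 * e - 1 - ε) := by
        gcongr <;> linarith
      have h2 : 0 ≤ ε * ((2 * e - 1) * (2 * e - 1 - ε) / 4 - (e - 1)) :=
        mul_nonneg hε.le (by linarith)
      linarith
    -- The map `z ↦ z / (1 + z)` is increasing and sends `1 - 1/e` to `(e - 1) / (2 * e - 1)`.
    have hq2 : (e - 1) / (2 * e - 1) ≤ (β + 2 * ε / 3) / (1 + β + 2 * ε / 3) := by
      rw [div_le_div_iff₀ (by linarith) (by linarith)]
      have h3 : e - 1 ≤ (β + 2 * ε / 3) * e := by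
        have : (1 - 1 / e) * e ≤ (β + 2 * ε / 3) * e := by
          gcongr
          linarith
        rw [sub_mul, one_div, inv_mul_cancel₀ (by linarith)] at this
        linarith
      nlinarith
    have hq3 : (β + 2 * ε / 3) / (1 + β + 2 * ε / 3) * (1 + β) ≤ β + 2 * ε / 3 := by
      rw [div_mul_eq_mul_div, div_le_iff₀ (by linarith)]
      nlinarith
    have hq4 : q ≤ (β + 2 * ε / 3) / (1 + β + 2 * ε / 3) - 7 / 4 * ε := by linarith
    have hq5 : q * (1 + β) ≤
        ((β + 2 * ε / 3) / (1 + β + 2 * ε / 3) - 7 / 4 * ε) * (1 + β) := by gcongr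
    nlinarith
  have h1β : 0 < 1 + β := by linarith
  have : (1 + β) * (q * y) < (1 + β) * x := by nlinarith
  exact lt_of_mul_lt_mul_left this h1β.le

/-- The approximation guarantee of a run of Smooth-Greedy whose smooth values are accurate. -/
lemma IsSmoothGreedyOutput.approximation {N : Type*} [Fintype N] [DecidableEq N]
    {f g : Finset N → ℝ} (hf : Monotone f) (hs : IsSubmodular f) (h0 : 0 ≤ f ∅)
    {ε : ℝ} (hε : 0 < ε) (hε' : ε < Real.exp 1 - 1) {H S : Finset N} {k : ℕ} (hk : 0 < k)
    (hopt : 0 < optValue f k) (hH : 3 * (H.card : ℝ) ≤ k * ε)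
    (hacc : ∀ S a b, Disjoint (insert a S) H → Disjoint (insert b S) H → S.card + H.card < k →
      smoothing g H (insert b S) ≤ smoothing g H (insert a S) →
      smoothing f H (insert b S) ≤
        (1 + min (ε / 3) (1 / 2) / k) * smoothing f H (insert a S))
    (hS : IsSmoothGreedyOutput g k H S) :
    ((Real.exp 1 - 1) / (2 * Real.exp 1 - 1 - ε) - 2 * ε) * optValue f k < f (S ∪ H) := by
  have he3 : Real.exp 1 < 2.8 := by
    have := Real.exp_one_lt_d9
    linarith
  set ε₁ := min (ε / 3) (1 / 2) with hε₁
  have hε₁0 : 0 < ε₁ := lt_min (by linarith) (by norm_num)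
  have hε₁1 : ε₁ ≤ 1 / 2 := min_le_right _ _
  have hk0 : (0 : ℝ) < k := by exact_mod_cast hk
  have hk1 : (1 : ℝ) ≤ k := by exact_mod_cast hk
  have hHk : H.card ≤ k := by
    have : (H.card : ℝ) ≤ k := by nlinarith
    exact_mod_cast this
  obtain ⟨O', hO', hOopt⟩ := Finset.exists_mem_eq_sup'
    (s := Finset.univ.filter (fun T : Finset N => T.card ≤ k)) ⟨∅, by simp⟩ f
  have hO'k : O'.card ≤ k := by simpa using hO'
  have hy : optValue f k = f O' := hOopt
  set O := O' \ H with hO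
  have hbound := hS.1.lower_bound hf hs h0 (η := ε₁ / k) (by positivity) (O := O) hk
    ((Finset.card_le_card Finset.sdiff_subset).trans hO'k) Finset.sdiff_disjoint hacc
  have hcard : S.card + H.card = k :=
    le_antisymm (hS.1.card_le hHk) (not_lt.1 hS.2)
  have hcard' : (S.card : ℝ) + H.card = k := by exact_mod_cast hcard
  set t := S.card
  have htk : (t : ℝ) ≤ k := by
    have : (0 : ℝ) ≤ H.card := by positivity
    linarith
  have hnn : ∀ T, 0 ≤ f T := fun T => h0.trans (hf (Finset.empty_subset T))
  have hη1 : ε₁ / k ≤ 1 := by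
    rw [div_le_one hk0]
    linarith
  have hη0 : 0 < ε₁ / k := by positivity
  -- Bernoulli gives `1 - ε₁ ≤ (1 - ε₁ / k) ^ t`, and the product with `(1 + ε₁ / k) ^ t` is at most
  -- `1`.
  have hpow : (1 - ε₁) * (1 + ε₁ / k) ^ t ≤ 1 := by
    have hb : 1 - ε₁ ≤ (1 - ε₁ / k) ^ t := by
      have h1 := one_add_mul_le_pow (a := -(ε₁ / k)) (by linarith) t
      have h2 : (t : ℝ) * (ε₁ / k) ≤ ε₁ := by
        rw [mul_div_assoc', div_le_iff₀ hk0]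
        nlinarith
      rw [← sub_eq_add_neg] at h1
      linarith
    calc (1 - ε₁) * (1 + ε₁ / k) ^ t ≤ (1 - ε₁ / k) ^ t * (1 + ε₁ / k) ^ t := by gcongr
      _ = (1 - (ε₁ / k) ^ 2) ^ t := by
        rw [← mul_pow]
        congr 1
        ring
      _ ≤ 1 := pow_le_one₀ (by nlinarith) (by nlinarith)
  -- Greedy makes only `t = k - H.card` steps; the missing ones cost `H.card / k ≤ ε / 3` in the
  -- exponent.
  have hq : (1 - 1 / (k : ℝ)) ^ t ≤ Real.exp (-1 + ε / 3) := by
    have h1 : 1 - 1 / (k : ℝ) ≤ Real.exp (-(1 / k)) := by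
      have := Real.add_one_le_exp (-(1 / (k : ℝ)))
      linarith
    have h2 : 0 ≤ 1 - 1 / (k : ℝ) := by
      rw [sub_nonneg, div_le_one hk0]
      exact hk1
    refine (pow_le_pow_left₀ h2 h1 t).trans ?_
    rw [← Real.exp_nat_mul, Real.exp_le_exp]
    have : (t : ℝ) * -(1 / k) = -1 + H.card / k := by
      rw [← eq_sub_iff_add_eq] at hcard'
      rw [hcard']
      field_simp
      ring
    rw [this]
    gcongr 1
    rw [div_le_div_iff₀ hk0 (by norm_num)]
    linarith
  have hβ0 : 0 ≤ (1 - ε₁) * (1 - Real.exp (-1 + ε / 3)) := by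
    have : Real.exp (-1 + ε / 3) ≤ 1 := Real.exp_le_one_iff.2 (by linarith)
    apply mul_nonneg <;> linarith
  have hgreedy : (1 - ε₁) * (1 - Real.exp (-1 + ε / 3)) * f O ≤ f (S ∪ H) := by
    calc (1 - ε₁) * (1 - Real.exp (-1 + ε / 3)) * f O
        = (1 - ε₁) * ((1 - Real.exp (-1 + ε / 3)) * f O) := by ring
      _ ≤ (1 - ε₁) * ((1 - (1 - 1 / (k : ℝ)) ^ t) * f O) := by
        have := hnn O
        have : 0 ≤ 1 - ε₁ := by linarith
        gcongr
      _ ≤ (1 - ε₁) * ((1 + ε₁ / k) ^ t * smoothing f H S) := by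
        have : 0 ≤ 1 - ε₁ := by linarith
        gcongr
      _ = (1 - ε₁) * (1 + ε₁ / k) ^ t * smoothing f H S := by ring
      _ ≤ 1 * smoothing f H S := by
        have := (hnn S).trans (le_smoothing hf H S)
        gcongr
      _ ≤ f (S ∪ H) := by
        rw [one_mul]
        exact smoothing_le hf H S
  have hsplit : f O' ≤ f O + f (S ∪ H) := by
    have h1 : f O' ≤ f (O ∪ H) := hf (by
      rw [hO, Finset.sdiff_union_self_eq_union]
      exact Finset.subset_union_left)
    have h2 := hs O H
    have h3 := hnn (O ∩ H)
    have h4 : f H ≤ f (S ∪ H) := hf Finset.subset_union_right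
    linarith
  refine approximation_factor_bound hε hε' le_rfl hopt ?_
  rw [hy]
  refine le_trans ?_ hgreedy
  gcongr
  linarith

/-! ### The union bound and the main theorem. -/

/-- The constant `6` gives `exp (-x) ≤ n ^ (-6k)`, against `(n + 1) ^ k * 2 ≤ n ^ (2k + 1)`; then
`2k + 4 ≤ 6k` as `k ≥ 1`. -/
lemma union_bound_le_one_div_pow {n k : ℕ} (hn : 2 ≤ n) (hk : 0 < k) {c R x : ℝ} (hc : 0 < c)
    (hR : 6 / c * k ^ 3 * Real.logb 2 n ≤ R) (hx : x = c / k ^ 2 * R) :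
    ((n : ℝ) + 1) ^ k * (2 * Real.exp (-x)) ≤ 1 / (n : ℝ) ^ 3 := by
  have hn2 : (2 : ℝ) ≤ n := by exact_mod_cast hn
  have hn0 : (0 : ℝ) < n := by linarith
  have hk0 : (0 : ℝ) < k := by exact_mod_cast hk
  have hlog : Real.log n ≤ Real.logb 2 n := by
    have h1 : Real.log 2 ≤ 1 := by
      have := Real.log_two_lt_d9
      linarith
    rw [Real.logb, le_div_iff₀ (Real.log_pos (by norm_num))]
    have := Real.log_nonneg (by linarith : (1 : ℝ) ≤ n)
    nlinarith
  have hx6 : (6 * k : ℕ) * Real.log n ≤ x := by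
    calc ((6 * k : ℕ) : ℝ) * Real.log n ≤ (6 * k : ℕ) * Real.logb 2 n := by gcongr
      _ = c / k ^ 2 * (6 / c * k ^ 3 * Real.logb 2 n) := by
        push_cast
        field_simp
      _ ≤ c / k ^ 2 * R := by gcongr
      _ = x := hx.symm
  have hexp : Real.exp (-x) ≤ 1 / (n : ℝ) ^ (6 * k) := by
    rw [one_div, Real.exp_neg]
    refine inv_anti₀ (by positivity) ?_
    refine le_trans (le_of_eq ?_) (Real.exp_le_exp.2 hx6)
    rw [Real.exp_nat_mul, Real.exp_log hn0]
  calc ((n : ℝ) + 1) ^ k * (2 * Real.exp (-x))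
      ≤ ((n : ℝ) ^ 2) ^ k * (n * (1 / (n : ℝ) ^ (6 * k))) := by
        gcongr
        nlinarith
    _ = (n : ℝ) ^ (2 * k + 1) / (n : ℝ) ^ (6 * k) := by
        rw [← pow_mul, pow_succ]
        ring
    _ ≤ 1 / (n : ℝ) ^ 3 := by
        rw [div_le_div_iff₀ (by positivity) (by positivity), one_mul, ← pow_add]
        exact pow_le_pow_right₀ (by linarith) (by omega)

theorem mainTheorem9
    (D : Measure ℝ) [IsProbabilityMeasure D]
    (hD : HasGeneralizedExponentialTail D)
    -- exponential integrability on the negative side; automatic for nonnegative noise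
    (hDneg : ∃ c : ℝ, 0 < c ∧ Integrable (fun x : ℝ => Real.exp (-(c * x))) D)
    (hDmean : 0 < ∫ x, x ∂D)
    (ε : ℝ) (hε : 0 < ε) (hε' : ε < Real.exp 1 - 1) :
    ∃ n₀ : ℕ, ∀ n : ℕ, n₀ ≤ n →
      ∀ (N : Type*) [Fintype N] [DecidableEq N], Fintype.card N = n →
      ∀ (f : Finset N → ℝ), Monotone f → IsSubmodular f → 0 ≤ f ∅ →
      ∀ k : ℕ, k ≤ n → 0 < optValue f k →
      ∀ H : Finset N, H.card = smoothingSize n k → 3 * (H.card : ℝ) / ε < (k : ℝ) →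
      ∀ (Ω : Type*) [MeasurableSpace Ω] (P : Measure Ω) [IsProbabilityMeasure P]
        (ftilde : Finset N → Ω → ℝ), IsNoisyOracle D P f ftilde →
        1 - 1 / (n : ℝ) ^ 3 ≤
          P.real {ω | (∃ S, IsSmoothGreedyOutput (fun T => ftilde T ω) k H S) ∧
            ∀ S, IsSmoothGreedyOutput (fun T => ftilde T ω) k H S →
              ((Real.exp 1 - 1) / (2 * Real.exp 1 - 1 - ε) - 2 * ε) * optValue f k
                < f (S ∪ H)} := by
  obtain ⟨c₁, hc₁, hint₁⟩ := hD.exists_integrable_exp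
  obtain ⟨c₂, hc₂, hint₂⟩ := hDneg
  obtain ⟨K₀, s₀, hK₀, hs₀, hmgf₀⟩ := exists_integral_exp_centred_le hc₁ hc₂ hint₁ hint₂
  set m := ∫ x, x ∂D with hm
  -- Enlarging `K` keeps the moment bound and makes the Chernoff parameter admissible for every `δ ≤
  -- 1`.
  set K := max K₀ (m / (2 * s₀)) with hKdef
  have hK : 0 < K := lt_max_of_lt_left hK₀
  have hmK : m ≤ 2 * K * s₀ := by
    have : m / (2 * s₀) ≤ K := le_max_right _ _
    rw [div_le_iff₀ (by positivity)] at this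
    linarith
  have hmgf : ∀ s, |s| ≤ s₀ → Integrable (fun x => Real.exp (s * (x - m))) D ∧
      ∫ x, Real.exp (s * (x - m)) ∂D ≤ Real.exp (K * s ^ 2) := fun s h =>
    ⟨(hmgf₀ s h).1, (hmgf₀ s h).2.trans (by
      gcongr
      exact le_max_left _ _)⟩
  set ε₁ := min (ε / 3) (1 / 2) with hε₁
  have hε₁0 : 0 < ε₁ := lt_min (by linarith) (by norm_num)
  have hε₁1 : ε₁ ≤ 1 / 2 := min_le_right _ _
  -- With `δ = ε₁ / (4 * k)`, the Chernoff exponent `(δ * m) ^ 2 / (4 * K) * (2 ^ ℓ / 2)` equals `c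
  -- / k ^ 2 * 2 ^ ℓ`.
  set c := (ε₁ * m) ^ 2 / (128 * K) with hc
  have hc0 : 0 < c := by positivity
  obtain ⟨n₀, hn₀, hsize⟩ := exists_le_two_pow_smoothingSize (6 / c)
  refine ⟨n₀, ?_⟩
  intro n hn N _ _ hN f hf hs h0 k hkn hopt H hH hHk Ω _ P _ ftilde hor
  have hn2 : 2 ≤ n := hn₀.trans hn
  have hk0 : (0 : ℝ) < k := lt_of_le_of_lt (by positivity) hHk
  have hk : 0 < k := by exact_mod_cast hk0
  have hk1 : (1 : ℝ) ≤ k := by exact_mod_cast hk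
  -- Two values accurate up to `δ` compare up to `(1 + δ) / (1 - δ)`, which is at most `1 + 4 * δ =
  -- 1 + ε₁ / k` because `δ ≤ 1 / 2`.
  set δ := ε₁ / (4 * k) with hδ
  have hδ0 : 0 < δ := by positivity
  have hδ1 : δ ≤ 1 / 2 := by
    rw [hδ, div_le_iff₀ (by positivity)]
    linarith
  have hδη : ε₁ / k = 4 * δ := by
    rw [hδ]
    field_simp
  set s := (Finset.univ.filter (fun T : Finset N => T.card ≤ k)).filter (Disjoint · H) with hsdef
  set p := 2 * Real.exp (-((δ * m) ^ 2 / (4 * K) * (2 ^ H.card / 2))) with hp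
  have hgood := one_sub_card_mul_le_measureReal (P := P) s
    (fun X => {ω | δ * (m * smoothing f H X) <
        |smoothing (fun T => ftilde T ω) H X - m * smoothing f H X|})
    {ω | (∃ S, IsSmoothGreedyOutput (fun T => ftilde T ω) k H S) ∧
      ∀ S, IsSmoothGreedyOutput (fun T => ftilde T ω) k H S →
        ((Real.exp 1 - 1) / (2 * Real.exp 1 - 1 - ε) - 2 * ε) * optValue f k < f (S ∪ H)}
    (p := p)
    (fun X hX => hor.measureReal_smoothing_error_le hf hs h0 hDmean hK hmgf hδ0
      (by nlinarith) (Finset.mem_filter.1 hX).2)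
    (by
      intro ω hω
      refine ⟨exists_isSmoothGreedyOutput _ (hN ▸ hkn) H, fun S hS => ?_⟩
      refine hS.approximation hf hs h0 hε hε' hk hopt ?_ ?_
      · rw [div_lt_iff₀ hε] at hHk
        exact hHk.le
      · intro S a b ha hb hcard hle
        rw [hδη]
        have hmem : ∀ x, Disjoint (insert x S) H → insert x S ∈ s := fun x hx => by
          have := Finset.card_insert_le x S
          simp only [hsdef, Finset.mem_filter, Finset.mem_univ, true_and]
          exact ⟨by omega, hx⟩
        have ea := hω _ (hmem a ha)
        have eb := hω _ (hmem b hb)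
        rw [Set.mem_ofPred_eq, not_lt] at ea eb
        have ea' := (abs_le.1 ea).2
        have eb' := (abs_le.1 eb).1
        set A := smoothing f H (insert a S)
        set B := smoothing f H (insert b S)
        have hA : 0 ≤ A :=
          (h0.trans (hf (Finset.empty_subset _))).trans (le_smoothing hf H _)
        have h1 : m * ((1 - δ) * B) ≤ m * ((1 + δ) * A) := by linarith
        have h2 : (1 - δ) * B ≤ (1 + δ) * A := le_of_mul_le_mul_left h1 hDmean
        have h3 : (1 + δ) * A ≤ (1 - δ) * ((1 + 4 * δ) * A) := by
          rw [← mul_assoc]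
          gcongr
          nlinarith
        exact le_of_mul_le_mul_left (h2.trans h3) (by linarith))
  refine le_trans ?_ hgood
  have hcard : (s.card : ℝ) ≤ ((n : ℝ) + 1) ^ k := by
    have : s.card ≤ _ := (Finset.card_filter_le _ _).trans (card_filter_card_le_le_pow (N := N) k)
    rw [hN] at this
    exact_mod_cast this
  have hp0 : 0 ≤ p := by positivity
  have hfinal := union_bound_le_one_div_pow hn2 hk hc0 (R := 2 ^ H.card)
    (x := (δ * m) ^ 2 / (4 * K) * (2 ^ H.card / 2)) (by
      rw [hH]
      exact hsize n hn k hkn) (by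
      rw [hc, hδ]
      field_simp
      ring)
  have := mul_le_mul_of_nonneg_right hcard hp0
  linarith
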